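/- **Setting.** A polyhedron in $\mathbb{R}^d$ is a finite intersection of closed halfspaces; a polytope is a non-empty bounded polyhedron; $h_Q(u)=\max_{x\in Q}\langle x,u\rangle$ is the support function of a polytope $Q$. The normal fan $\mathcal N(Q)$ of a polyhedron $Q$ is the set of the normal cones $N_F(Q)=\{x:\langle x,y\rangle\le\langle x,p\rangle \text{ for all } y\in Q,\ p\in F\}$ over all non-empty faces $F$ of $Q$. Let $\Delta$ be a simplicial polytopal fan in $\mathbb{R}^d$, that is, the normal fan of a non-empty polyhedron, all of whose cones are generated by linearly independent vectors, and let $v_1,\dots,v_n$ be its ray generators (one non-zero vector on each one-dimensional cone of $\Delta$). The deformation cone $\mathcal P(\Delta)$ is the set of all polytopes $Q$ whose normal fan is a coarsening of $\Delta$, i.e. every cone of $\mathcal N(Q)$ is a union of cones of $\Delta$. Given directions $u^{(1)},u^{(2)},\dots$ and real numbers $y^{(1)},y^{(2)},\dots$, a least-squares estimate from the first $m$ data points is a minimizer over $Q\in\mathcal P(\Delta)$ of $\frac1m\sum_{l=1}^m\big(h_Q(u^{(l)})-y^{(l)}\big)^2$. **Corollary 4.3.** Let $u^{(l)}\in\{v_1/\|v_1\|,\dots,v_n/\|v_n\|\}$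 for all $l\ge 1$, and suppose there are $\delta>0$ and $N\in\mathbb{N}$ such that $$|\{l\in\{1,\dots,m\}: u^{(l)}=v_i/\|v_i\|\}|\ \ge\ m\delta\qquad\text{for all } m\ge N \text{ and all } 1\le i\le n .$$ Let $P\in\mathcal P(\Delta)$ and let $\varepsilon^{(1)},\varepsilon^{(2)},\dots$ be independent random variables on a probability space with $\varepsilon^{(l)}\sim\mathcal N(0,\sigma_l^2)$ and $\sigma_l^2\le\gamma<\infty$ for all $l$. Put $y^{(l)}=h_P(u^{(l)})+\varepsilon^{(l)}$. Then for every $m\ge\max(N,1)$ the least-squares estimate $\hat P_m$ from the first $m$ data points exists and is unique (indeed for arbitrary data $y\in\mathbb{R}^m$), and almost surely $\hat P_m$ converges to $P$ in Hausdorff distance as $m\to\infty$. -/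

import Mathlib

open Filter Topology MeasureTheory ProbabilityTheory

/-- A polyhedron: an intersection of finitely many closed halfspaces. -/
def IsPolyhedron {E : Type*} [NormedAddCommGroup E] [InnerProductSpace ℝ E] (P : Set E) : Prop :=
  ∃ (k : ℕ) (a : Fin k → E) (b : Fin k → ℝ), P = {x | ∀ i, inner ℝ (a i) x ≤ b i}

/-- A polytope: a non-empty bounded polyhedron. -/
def IsPolytope {E : Type*} [NormedAddCommGroup E] [InnerProductSpace ℝ E] (P : Set E) : Prop :=
  IsPolyhedron P ∧ P.Nonempty ∧ Bornology.IsBounded P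

/-- The support function `h_P(u) = max_{x ∈ P} ⟨x, u⟩` (for a polytope the supremum below is
attained). -/
noncomputable def supportFunction {E : Type*} [NormedAddCommGroup E] [InnerProductSpace ℝ E]
    (P : Set E) (u : E) : ℝ :=
  sSup ((fun x => inner ℝ x u) '' P)

/-- The normal cone of `P` at `F`: the vectors `x` such that the maximum of `⟨x, ·⟩` over `P` is
attained at every point of `F`. -/
def normalCone {E : Type*} [NormedAddCommGroup E] [InnerProductSpace ℝ E] (P F : Set E) : Set E :=
  {x | ∀ p ∈ F, ∀ y ∈ P, (inner ℝ x y : ℝ) ≤ inner ℝ x p}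

/-- The normal fan of a polyhedron `P`: all normal cones of `P` at its non-empty faces
(`P` itself being a face). -/
def normalFan {E : Type*} [NormedAddCommGroup E] [InnerProductSpace ℝ E] (P : Set E) :
    Set (Set E) :=
  {C | ∃ F : Set E, F.Nonempty ∧ IsExposed ℝ P F ∧ C = normalCone P F}

/-- `Δ` refines `Δ'` (`Δ'` coarsens `Δ`): every cone of `Δ'` is a union of cones of `Δ`. -/
def FanRefines {E : Type*} (Δ Δ' : Set (Set E)) : Prop :=
  ∀ σ' ∈ Δ', ∃ S ⊆ Δ, σ' = ⋃₀ S

/-- A simplicial polytopal fan: the normal fan of a (non-empty) polyhedron, all of whose cones are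
generated by finitely many linearly independent vectors. -/
def IsSimplicialPolytopalFan {E : Type*} [NormedAddCommGroup E] [InnerProductSpace ℝ E]
    (Δ : Set (Set E)) : Prop :=
  (∃ P : Set E, IsPolyhedron P ∧ P.Nonempty ∧ normalFan P = Δ) ∧
    ∀ σ ∈ Δ, ∃ C : PointedCone ℝ E, C.IsSimplicial ∧ (C : Set E) = σ

/-- The one-dimensional cones of a fan. -/
def fanRays {E : Type*} [NormedAddCommGroup E] [InnerProductSpace ℝ E]
    (Δ : Set (Set E)) : Set (Set E) :=
  {σ | σ ∈ Δ ∧ Module.finrank ℝ (Submodule.span ℝ σ) = 1}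

/-- `v_1, …, v_n` are the ray generators of `Δ`: the cones `pos {v_i}` are, without repetition,
exactly the one-dimensional cones of `Δ`. -/
def IsRayGenerators {E : Type*} [NormedAddCommGroup E] [InnerProductSpace ℝ E] {n : ℕ}
    (Δ : Set (Set E)) (v : Fin n → E) : Prop :=
  Set.BijOn (fun i => ((PointedCone.hull ℝ {v i} : PointedCone ℝ E) : Set E)) Set.univ (fanRays Δ)

/-- The deformation cone `𝒫(Δ)`: all polytopes whose normal fan is a coarsening of `Δ`. -/
def deformationCone {E : Type*} [NormedAddCommGroup E] [InnerProductSpace ℝ E]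
    (Δ : Set (Set E)) : Set (Set E) :=
  {Q | IsPolytope Q ∧ FanRefines Δ (normalFan Q)}

/-- The least-squares estimates in `𝒫(Δ)` from the first `m` data points `(u l, y l)`, `l < m`: the
minimizers `Q ∈ 𝒫(Δ)` of `(1/m) ∑_{l < m} (h_Q(u l) - y l)²`. -/
def leastSquaresEstimates {E : Type*} [NormedAddCommGroup E] [InnerProductSpace ℝ E]
    (Δ : Set (Set E)) (u : ℕ → E) (y : ℕ → ℝ) (m : ℕ) : Set (Set E) :=
  {Q | Q ∈ deformationCone Δ ∧ ∀ R ∈ deformationCone Δ,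
    (1 / (m : ℝ)) * ∑ l ∈ Finset.range m, (supportFunction Q (u l) - y l) ^ 2 ≤
      (1 / (m : ℝ)) * ∑ l ∈ Finset.range m, (supportFunction R (u l) - y l) ^ 2}

/-! ### Normal fans and their simplicial cones -/

section NormalFans

variable {E : Type*} [NormedAddCommGroup E] [InnerProductSpace ℝ E]

/-! A polytope in the deformation cone is determined by its support values at the unit ray
generators, so the problem is one of least squares in ℝⁿ. The admissible vectors form a closed
convex set `supportVectors`; `circumscribed` is the inverse map, and the Hausdorff distance is
Lipschitz in the support values (`exists_hausdorffDist_le_mul`). The geometric source of all this is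
that any polytope in the deformation cone forces the fan to be complete, and its support function is
linear on each cone.

Existence and uniqueness: once every direction is observed, the objective is coercive and strictly
convex in ℝⁿ (`existsUnique_isLeast_sum_sq`).

Consistency: let `g` be the difference of the support vectors of the estimate and of `P`. Optimality
against `P` gives ∑ g² ≤ 2 ∑ g·ε over the data. Grouping by direction, the frequency bound and
Young's inequality bound |g|² by a constant times the squared errors summed per direction and
divided by `m` (`sum_sq_le_of_sum_sq_sub_le`). These averages tend to 0 almost surely by a strong
law for uniformly sub-Gaussian variables. -/

theorem mem_hull_image_finset {ι : Type*} (w : ι → E) (J : Finset ι) (x : E) :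
    x ∈ PointedCone.hull ℝ (w '' J) ↔
      ∃ c : ι → ℝ, (∀ j, 0 ≤ c j) ∧ ∑ j ∈ J, c j • w j = x := by
  classical
  constructor
  · intro hx
    induction hx using Submodule.span_induction with
    | mem x hx =>
      obtain ⟨j, hj, rfl⟩ := hx
      refine ⟨Pi.single j 1, fun i => ?_, ?_⟩
      · by_cases h : i = j
        · subst h; simp
        · simp [h]
      · rw [Finset.sum_eq_single_of_mem j hj]
        · simp
        · intro b _ hb; simp [hb]
    | zero => exact ⟨0, by simp, by simp⟩
    | add x y _ _ hx hy =>
      obtain ⟨c, hc, rfl⟩ := hx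
      obtain ⟨c', hc', rfl⟩ := hy
      exact ⟨c + c', fun j => add_nonneg (hc j) (hc' j), by
        simp [add_smul, Finset.sum_add_distrib]⟩
    | smul a x _ hx =>
      obtain ⟨c, hc, rfl⟩ := hx
      refine ⟨fun j => (a : ℝ) * c j, fun j => mul_nonneg a.2 (hc j), ?_⟩
      rw [Finset.smul_sum]
      exact Finset.sum_congr rfl fun j _ => mul_smul _ _ _
  · rintro ⟨c, hc, rfl⟩
    refine Submodule.sum_mem _ fun j hj => ?_
    exact Submodule.smul_mem _ (⟨c j, hc j⟩ : {c : ℝ // 0 ≤ c})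
      (Submodule.subset_span ⟨j, hj, rfl⟩)

/-- Take a point whose set of active constraints is minimal. Its midpoint with `x` is active only
where both are, so minimality makes `x` active there too. -/
theorem exists_mem_forall_eq_of_convex {k : ℕ} (a : Fin k → E) (b : Fin k → ℝ) {F : Set E}
    (hF : ∀ x ∈ F, ∀ i, inner ℝ (a i) x ≤ b i) (hconv : Convex ℝ F) (hne : F.Nonempty) :
    ∃ f ∈ F, ∀ i, inner ℝ (a i) f = b i → ∀ x ∈ F, inner ℝ (a i) x = b i := by
  classical
  let t : E → Finset (Fin k) := fun x => Finset.univ.filter fun i => inner ℝ (a i) x = b i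
  obtain ⟨f, hfF, hf⟩ := exists_minimalFor_of_wellFoundedLT (fun x => x ∈ F) t hne
  refine ⟨f, hfF, fun i hi x hx => ?_⟩
  let y : E := (1 / 2 : ℝ) • f + (1 / 2 : ℝ) • x
  have hy : y ∈ F := hconv hfF hx (by norm_num) (by norm_num) (by norm_num)
  have key : ∀ j, inner ℝ (a j) y = b j → inner ℝ (a j) f = b j ∧ inner ℝ (a j) x = b j := by
    intro j hj
    simp only [y, inner_add_right, inner_smul_right] at hj
    constructor <;> linarith [hF f hfF j, hF x hx j]
  have hsub : t y ⊆ t f := fun j hj => by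
    simp only [t, Finset.mem_filter, Finset.mem_univ, true_and] at hj ⊢
    exact (key j hj).1
  have : i ∈ t y := hf hy hsub (by simpa [t] using hi)
  exact (key i (by simpa [t] using this)).2

theorem IsPolyhedron.convex {P : Set E} (hP : IsPolyhedron P) : Convex ℝ P := by
  obtain ⟨k, a, b, rfl⟩ := hP
  intro x hx y hy s t hs ht hst i
  simp only [inner_add_right, inner_smul_right]
  calc s * inner ℝ (a i) x + t * inner ℝ (a i) y ≤ s * b i + t * b i :=
        add_le_add (mul_le_mul_of_nonneg_left (hx i) hs) (mul_le_mul_of_nonneg_left (hy i) ht)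
    _ = b i := by rw [← add_mul, hst, one_mul]

theorem IsPolyhedron.isClosed {P : Set E} (hP : IsPolyhedron P) : IsClosed P := by
  obtain ⟨k, a, b, rfl⟩ := hP
  simp only [Set.ofPred_forall]
  exact isClosed_iInter fun i => isClosed_le (by fun_prop) continuous_const

theorem IsPolytope.isCompact [FiniteDimensional ℝ E] {P : Set E} (hP : IsPolytope P) :
    IsCompact P :=
  haveI := FiniteDimensional.proper ℝ E
  Metric.isCompact_of_isClosed_isBounded hP.1.isClosed hP.2.2

theorem isExposed_inner (P : Set E) (u : E) :
    IsExposed ℝ P {x ∈ P | ∀ y ∈ P, (inner ℝ u y : ℝ) ≤ inner ℝ u x} :=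
  fun _ => ⟨innerSL ℝ u, by simp⟩

/-- Faces of simplicial cones of the normal fan of a polyhedron belong to the fan. -/
theorem hull_image_mem_normalFan [FiniteDimensional ℝ E] {P : Set E} (hP : IsPolyhedron P)
    {ι : Type*} {w : ι → E} {I J : Finset ι} (hw : LinearIndepOn ℝ w (I : Set ι))
    (hI : (PointedCone.hull ℝ (w '' I) : Set E) ∈ normalFan P) (hJ : J ⊆ I) :
    (PointedCone.hull ℝ (w '' J) : Set E) ∈ normalFan P := by
  classical
  obtain ⟨F, hFne, hFexp, hF⟩ := hI
  have hmem : ∀ i ∈ I, w i ∈ normalCone P F := fun i hi =>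
    hF ▸ Submodule.subset_span ⟨i, hi, rfl⟩
  have hFP : F ⊆ P := hFexp.subset
  -- `u` weights every generator of the smaller cone positively, so the face `G` it exposes is the
  -- one whose normal cone should be that cone.
  set u : E := ∑ j ∈ J, w j with hu
  set G : Set E := {x ∈ P | ∀ y ∈ P, (inner ℝ u y : ℝ) ≤ inner ℝ u x} with hG
  have hFG : F ⊆ G := by
    intro f hf
    refine ⟨hFP hf, fun y hy => ?_⟩
    simp only [hu, sum_inner]
    exact Finset.sum_le_sum fun j hj => hmem j (hJ hj) f hf y hy
  refine ⟨G, hFne.mono hFG, isExposed_inner P u, ?_⟩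
  obtain ⟨f₀, hf₀⟩ := hFne
  apply Set.Subset.antisymm
  · intro x hx
    obtain ⟨c, hc, rfl⟩ := (mem_hull_image_finset w J x).1 hx
    intro p hp y hy
    have hpe : ∀ j ∈ J, (inner ℝ (w j) p : ℝ) = inner ℝ (w j) f₀ := by
      have h1 : ∀ j ∈ J, (inner ℝ (w j) p : ℝ) ≤ inner ℝ (w j) f₀ := fun j hj =>
        hmem j (hJ hj) f₀ hf₀ p hp.1
      have h2 := hp.2 f₀ (hFP hf₀)
      simp only [hu, sum_inner] at h2
      exact (Finset.sum_eq_sum_iff_of_le h1).1 (le_antisymm (Finset.sum_le_sum h1) h2)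
    simp only [sum_inner, inner_smul_left]
    refine Finset.sum_le_sum fun j hj => mul_le_mul_of_nonneg_left ?_ (hc j)
    rw [hpe j hj]
    exact hmem j (hJ hj) f₀ hf₀ y hy
  · intro z hz
    have hzF : z ∈ (PointedCone.hull ℝ (w '' I) : Set E) := by
      rw [hF]
      exact fun p hp y hy => hz p (hFG hp) y hy
    obtain ⟨c, hc, hcz⟩ := (mem_hull_image_finset w I z).1 hzF
    have hzero : ∀ i ∈ I, i ∉ J → c i = 0 := by
      intro i hi hiJ
      by_contra hne
      have hpos : 0 < c i := lt_of_le_of_ne (hc i) (Ne.symm hne)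
      -- A dual vector to `w i`. Constraints active at the generic point `f` are active on all of
      -- `F`, so their normals lie in the cone and pair nonpositively with `q`. Hence `f + t • q`
      -- stays in the polyhedron, and in `G` as `u ⊥ q`; but `z` drops by `t * c i` along it.
      obtain ⟨q, hqi, hqj⟩ : ∃ q : E, (inner ℝ (w i) q : ℝ) = -1 ∧
          ∀ j ∈ I, j ≠ i → (inner ℝ (w j) q : ℝ) = 0 := by
        obtain ⟨l, hl⟩ := LinearMap.exists_extend
          (-(Finsupp.lapply (⟨i, hi⟩ : (I : Set ι))) ∘ₗ LinearIndependent.repr hw)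
        have hlw : ∀ j (hj : j ∈ I), l (w j) = -(Finsupp.single (⟨j, hj⟩ : (I : Set ι)) (1 : ℝ)
            (⟨i, hi⟩ : (I : Set ι))) := by
          intro j hj
          have h := LinearMap.congr_fun hl
            ⟨w j, Submodule.subset_span (Set.mem_range_self (⟨j, hj⟩ : (I : Set ι)))⟩
          have h' := LinearIndependent.repr_eq_single hw (⟨j, hj⟩ : (I : Set ι))
            ⟨w j, Submodule.subset_span (Set.mem_range_self (⟨j, hj⟩ : (I : Set ι)))⟩ rfl
          simpa [h'] using h
        refine ⟨(InnerProductSpace.toDual ℝ E).symm (LinearMap.toContinuousLinearMap l), ?_, ?_⟩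
        · rw [real_inner_comm, InnerProductSpace.toDual_symm_apply]
          simpa using hlw i hi
        · intro j hj hji
          rw [real_inner_comm, InnerProductSpace.toDual_symm_apply]
          simpa [Finsupp.single_apply, hji] using hlw j hj
      obtain ⟨k, a, b, rfl⟩ := hP
      have hFconv : Convex ℝ F := hFexp.convex (IsPolyhedron.convex ⟨k, a, b, rfl⟩)
      obtain ⟨f, hfF, hf⟩ := exists_mem_forall_eq_of_convex a b (fun x hx => hFP hx) hFconv
        ⟨f₀, hf₀⟩
      have htight : ∀ m, inner ℝ (a m) f = b m → (inner ℝ (a m) q : ℝ) ≤ 0 := by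
        intro m hm
        have : a m ∈ (PointedCone.hull ℝ (w '' I) : Set E) := by
          rw [hF]
          intro p hp y hy
          rw [hf m hm p hp]
          exact hy m
        obtain ⟨e, he, hea⟩ := (mem_hull_image_finset w I _).1 this
        rw [← hea, sum_inner]
        refine Finset.sum_nonpos fun j hj => ?_
        rw [inner_smul_left]
        refine mul_nonpos_of_nonneg_of_nonpos (he j) ?_
        by_cases hji : j = i
        · rw [hji, hqi]; norm_num
        · rw [hqj j hj hji]
      obtain ⟨t, ht, htP⟩ : ∃ t : ℝ, 0 < t ∧ ∀ m, inner ℝ (a m) (f + t • q) ≤ b m := by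
        have hev : ∀ m, ∀ᶠ t : ℝ in 𝓝[>] 0, inner ℝ (a m) (f + t • q) ≤ b m := by
          intro m
          rcases (hFP hfF m).eq_or_lt with h | h
          · filter_upwards [self_mem_nhdsWithin] with t ht
            rw [inner_add_right, inner_smul_right, h]
            have := mul_nonpos_of_nonneg_of_nonpos (le_of_lt ht) (htight m h)
            linarith
          · have hcont : Continuous fun t : ℝ => (inner ℝ (a m) (f + t • q) : ℝ) := by fun_prop
            have : ∀ᶠ t : ℝ in 𝓝 0, inner ℝ (a m) (f + t • q) < b m :=
              hcont.continuousAt.eventually_lt continuousAt_const (by simpa using h)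
            exact (this.filter_mono nhdsWithin_le_nhds).mono fun t ht => ht.le
        obtain ⟨t, h1, h2⟩ := ((eventually_all.2 hev).and self_mem_nhdsWithin).exists
        exact ⟨t, h2, h1⟩
      have hxG : f + t • q ∈ {x ∈ {x | ∀ i, (inner ℝ (a i) x : ℝ) ≤ b i} |
          ∀ y ∈ {x | ∀ i, (inner ℝ (a i) x : ℝ) ≤ b i}, (inner ℝ u y : ℝ) ≤ inner ℝ u x} := by
        refine ⟨htP, fun y hy => ?_⟩
        have huq : (inner ℝ u q : ℝ) = 0 := by
          rw [hu, sum_inner]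
          exact Finset.sum_eq_zero fun j hj => hqj j (hJ hj) fun h => hiJ (h ▸ hj)
        rw [inner_add_right, inner_smul_right, huq, mul_zero, add_zero]
        exact (hFG hfF).2 y hy
      have h1 := hz _ hxG f (hFP hfF)
      have hzq : (inner ℝ z q : ℝ) = - c i := by
        rw [← hcz, sum_inner, Finset.sum_eq_single_of_mem i hi]
        · rw [inner_smul_left, hqi]; simp
        · intro j hj hji
          rw [inner_smul_left, hqj j hj hji, mul_zero]
      rw [inner_add_right, inner_smul_right, hzq] at h1
      nlinarith
    refine (mem_hull_image_finset w J z).2 ⟨c, hc, ?_⟩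
    rw [← hcz]
    exact Finset.sum_subset hJ fun i hi hiJ => by rw [hzero i hi hiJ, zero_smul]

/-- If the normal fan of `Q` coarsens that of `P`, then every simplicial cone of the normal fan
of `P` lies in a normal cone of a point of `Q`. -/
theorem FanRefines.exists_forall_inner_le {P Q : Set E}
    (href : FanRefines (normalFan P) (normalFan Q)) (hQ : ∀ u : E, ∃ q ∈ Q, ∀ y ∈ Q,
      (inner ℝ u y : ℝ) ≤ inner ℝ u q) {ι : Type*} {w : ι → E} {I : Finset ι}
    (hI : (PointedCone.hull ℝ (w '' I) : Set E) ∈ normalFan P) :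
    ∃ p ∈ Q, ∀ i ∈ I, ∀ y ∈ Q, (inner ℝ (w i) y : ℝ) ≤ inner ℝ (w i) p := by
  obtain ⟨F, hFne, hFexp, hF⟩ := hI
  have hmem : ∀ i ∈ I, w i ∈ normalCone P F := fun i hi =>
    hF ▸ Submodule.subset_span ⟨i, hi, rfl⟩
  have hFP : F ⊆ P := hFexp.subset
  -- Any cone `τ` of the fan containing `u` contains all `w i`: points of its face maximize the sum
  -- `u` over `P`, hence each summand, since `f₀` maximizes all of them at once.
  set u : E := ∑ j ∈ I, w j with hu
  obtain ⟨q, hq, hqu⟩ := hQ u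
  let G : Set E := {x ∈ Q | ∀ y ∈ Q, (inner ℝ u y : ℝ) ≤ inner ℝ u x}
  have hqG : q ∈ G := ⟨hq, hqu⟩
  obtain ⟨S, hSΔ, hS⟩ := href (normalCone Q G) ⟨G, ⟨q, hqG⟩, isExposed_inner Q u, rfl⟩
  have huG : u ∈ normalCone Q G := fun p hp y hy => hp.2 y hy
  rw [hS] at huG
  obtain ⟨τ, hτS, huτ⟩ := huG
  refine ⟨q, hq, fun i hi => ?_⟩
  suffices w i ∈ normalCone Q G from this q hqG
  rw [hS]
  refine ⟨τ, hτS, ?_⟩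
  obtain ⟨F', -, hF'exp, rfl⟩ := hSΔ hτS
  intro g hg y hy
  obtain ⟨f₀, hf₀⟩ := hFne
  have hgP := hF'exp.subset hg
  have h1 : ∀ j ∈ I, (inner ℝ (w j) g : ℝ) ≤ inner ℝ (w j) f₀ := fun j hj =>
    hmem j hj f₀ hf₀ g hgP
  have h2 := huτ g hg f₀ (hFP hf₀)
  simp only [hu, sum_inner] at h2
  have h3 := (Finset.sum_eq_sum_iff_of_le h1).1 (le_antisymm (Finset.sum_le_sum h1) h2)
  rw [h3 i hi]
  exact hmem i hi f₀ hf₀ y hy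

theorem IsPolytope.exists_forall_inner_le [FiniteDimensional ℝ E] {Q : Set E}
    (hQ : IsPolytope Q) (u : E) : ∃ q ∈ Q, ∀ y ∈ Q, (inner ℝ u y : ℝ) ≤ inner ℝ u q := by
  obtain ⟨q, hq, h⟩ := hQ.isCompact.exists_isMaxOn hQ.2.1
    (f := fun x => (inner ℝ u x : ℝ)) (by fun_prop)
  exact ⟨q, hq, fun y hy => h hy⟩

/-- Completeness of the fan: every linear functional attains its maximum on a polytope. -/
theorem FanRefines.exists_mem [FiniteDimensional ℝ E] {Δ : Set (Set E)} {Q : Set E}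
    (hQ : IsPolytope Q) (href : FanRefines Δ (normalFan Q)) (u : E) : ∃ σ ∈ Δ, u ∈ σ := by
  obtain ⟨q, hq, hqu⟩ := hQ.exists_forall_inner_le u
  let G : Set E := {x ∈ Q | ∀ y ∈ Q, (inner ℝ u y : ℝ) ≤ inner ℝ u x}
  obtain ⟨S, hSΔ, hS⟩ := href (normalCone Q G) ⟨G, ⟨q, hq, hqu⟩, isExposed_inner Q u, rfl⟩
  have huG : u ∈ normalCone Q G := fun p hp y hy => hp.2 y hy
  rw [hS] at huG
  obtain ⟨τ, hτS, huτ⟩ := huG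
  exact ⟨τ, hSΔ hτS, huτ⟩

theorem IsRayGenerators.ne_zero {n : ℕ} {Δ : Set (Set E)} {v : Fin n → E}
    (hv : IsRayGenerators Δ v) (i : Fin n) : v i ≠ 0 := by
  intro h
  have := (hv.mapsTo (Set.mem_univ i)).2
  have hz : (PointedCone.hull ℝ {(0 : E)} : Set E) = {0} := by simp
  rw [h, hz] at this
  rw [Submodule.span_zero_singleton, finrank_bot] at this
  exact zero_ne_one this

theorem IsRayGenerators.hull_singleton_mem {n : ℕ} {Δ : Set (Set E)} {v : Fin n → E}
    (hv : IsRayGenerators Δ v) (i : Fin n) : (PointedCone.hull ℝ {v i} : Set E) ∈ Δ :=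
  (hv.mapsTo (Set.mem_univ i)).1

theorem mem_hull_singleton_iff (w x : E) :
    x ∈ PointedCone.hull ℝ {w} ↔ ∃ c : ℝ, 0 ≤ c ∧ c • w = x := by
  have := mem_hull_image_finset (fun _ : Unit => w) {()} x
  simp only [Finset.coe_singleton, Set.image_singleton, Finset.sum_singleton] at this
  rw [this]
  exact ⟨fun ⟨c, hc, h⟩ => ⟨c (), hc (), h⟩, fun ⟨c, hc, h⟩ => ⟨fun _ => c, fun _ => hc, h⟩⟩

/-- Every cone of a simplicial polytopal fan is generated by linearly independent ray generators. -/
theorem IsRayGenerators.exists_eq_hull [FiniteDimensional ℝ E] {n : ℕ} {Δ : Set (Set E)}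
    {v : Fin n → E} (hΔ : IsSimplicialPolytopalFan Δ) (hv : IsRayGenerators Δ v)
    {σ : Set E} (hσ : σ ∈ Δ) :
    ∃ I : Finset (Fin n), LinearIndepOn ℝ v (I : Set (Fin n)) ∧
      σ = PointedCone.hull ℝ (v '' I) := by
  classical
  obtain ⟨⟨P, hP, -, rfl⟩, hsimp⟩ := hΔ
  obtain ⟨C, ⟨s, hsfin, hsli, rfl⟩, rfl⟩ := hsimp σ hσ
  lift s to Finset E using hsfin
  -- Each generator of a simplicial cone spans a face of it, hence a ray of the fan.
  have hray : ∀ a : s, ∃ i : Fin n, ∃ t : ℝ, 0 < t ∧ v i = t • (a : E) := by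
    intro a
    have ha0 : (a : E) ≠ 0 := hsli.ne_zero a.2
    have hmem : (PointedCone.hull ℝ {(a : E)} : Set E) ∈ normalFan P := by
      have := hull_image_mem_normalFan hP (w := id) (I := s) (J := {(a : E)}) hsli
        (by simpa using hσ) (by simp)
      simpa using this
    have hr : (PointedCone.hull ℝ {(a : E)} : Set E) ∈ fanRays (normalFan P) := by
      refine ⟨hmem, ?_⟩
      have : Submodule.span ℝ (PointedCone.hull ℝ {(a : E)} : Set E) = Submodule.span ℝ {(a : E)} :=
        Submodule.span_span_of_tower _ _ _
      rw [this]
      exact finrank_span_singleton ha0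
    obtain ⟨i, -, hi⟩ := hv.surjOn hr
    have h1 : v i ∈ PointedCone.hull ℝ {(a : E)} := by
      have : v i ∈ (PointedCone.hull ℝ {v i} : Set E) := Submodule.subset_span rfl
      exact Set.ext_iff.1 hi _ |>.1 this
    obtain ⟨t, ht, hti⟩ := (mem_hull_singleton_iff _ _).1 h1
    refine ⟨i, t, lt_of_le_of_ne ht ?_, hti.symm⟩
    rintro rfl
    exact hv.ne_zero i (by simpa using hti.symm)
  choose i t ht hit using hray
  have hli : LinearIndependent ℝ (v ∘ i) := by
    have := LinearIndependent.units_smul hsli fun a => Units.mk0 (t a) (ht a).ne'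
    have heq : v ∘ i = (fun a => Units.mk0 (t a) (ht a).ne') • (fun a : s => (a : E)) :=
      funext hit
    rw [heq]
    exact this
  have hinj : Function.Injective i := hli.injective.of_comp
  refine ⟨Finset.univ.map ⟨i, hinj⟩, ?_, ?_⟩
  · simpa [linearIndepOn_range_iff hinj] using hli
  · apply Set.Subset.antisymm
    · refine SetLike.coe_subset_coe.2 (Submodule.span_le.2 fun a ha => ?_)
      have : a = (t ⟨a, ha⟩)⁻¹ • v (i ⟨a, ha⟩) := by
        rw [hit, smul_smul, inv_mul_cancel₀ (ht _).ne', one_smul]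
      rw [this]
      exact Submodule.smul_mem _ (⟨_, (inv_pos.2 (ht ⟨a, ha⟩)).le⟩ : {c : ℝ // 0 ≤ c})
        (Submodule.subset_span ⟨_, by simp, rfl⟩)
    · refine SetLike.coe_subset_coe.2 (Submodule.span_le.2 ?_)
      rintro _ ⟨j, hj, rfl⟩
      obtain ⟨a, rfl⟩ : ∃ a, i a = j := by simpa using hj
      rw [hit]
      exact Submodule.smul_mem _ (⟨_, (ht a).le⟩ : {c : ℝ // 0 ≤ c})
        (Submodule.subset_span a.2)

/-- In a complete simplicial fan, every vector is a positive combination of the generators of a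
cone. -/
theorem IsRayGenerators.exists_pos_combination [FiniteDimensional ℝ E] {n : ℕ} {Δ : Set (Set E)}
    {v : Fin n → E} (hΔ : IsSimplicialPolytopalFan Δ) (hv : IsRayGenerators Δ v)
    {Q : Set E} (hQ : Q ∈ deformationCone Δ) (u : E) :
    ∃ I : Finset (Fin n), LinearIndepOn ℝ v (I : Set (Fin n)) ∧
      (PointedCone.hull ℝ (v '' I) : Set E) ∈ Δ ∧
      ∃ c : Fin n → ℝ, (∀ i ∈ I, 0 < c i) ∧ u = ∑ i ∈ I, c i • v i := by
  classical
  obtain ⟨σ, hσ, huσ⟩ := hQ.2.exists_mem hQ.1 u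
  obtain ⟨I, hI, rfl⟩ := hv.exists_eq_hull hΔ hσ
  obtain ⟨c, hc, rfl⟩ := (mem_hull_image_finset v I u).1 huσ
  obtain ⟨⟨P, hP, -, rfl⟩, -⟩ := hΔ
  -- Dropping the zero coefficients passes to a face, which is again a cone of the fan.
  have hJ : I.filter (fun i => c i ≠ 0) ⊆ I := Finset.filter_subset _ _
  refine ⟨I.filter (fun i => c i ≠ 0), hI.mono hJ, hull_image_mem_normalFan hP hI hσ hJ, c,
    fun i hi => ?_, ?_⟩
  · exact lt_of_le_of_ne (hc i) (Finset.mem_filter.1 hi).2.symm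
  · refine (Finset.sum_subset hJ fun i hi hiJ => ?_).symm
    have : c i = 0 := by simpa [hi] using hiJ
    rw [this, zero_smul]

end NormalFans

/-! ### Support vectors as coordinates on the deformation cone -/

section DeformationCone

variable {E : Type*} [NormedAddCommGroup E] [InnerProductSpace ℝ E]

theorem supportFunction_eq_inner {Q : Set E} {u p : E} (hp : p ∈ Q)
    (h : ∀ y ∈ Q, (inner ℝ u y : ℝ) ≤ inner ℝ u p) : supportFunction Q u = inner ℝ u p := by
  refine IsGreatest.csSup_eq ⟨⟨p, hp, real_inner_comm _ _⟩, ?_⟩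
  rintro _ ⟨y, hy, rfl⟩
  simpa only [real_inner_comm u y] using h y hy

theorem IsPolytope.inner_le_supportFunction [FiniteDimensional ℝ E] {Q : Set E}
    (hQ : IsPolytope Q) (u : E) {x : E} (hx : x ∈ Q) : inner ℝ u x ≤ supportFunction Q u := by
  obtain ⟨q, hq, h⟩ := hQ.exists_forall_inner_le u
  rw [supportFunction_eq_inner hq h]
  exact h x hx

/-- The polyhedron cut out by the inequalities `⟨v i, x⟩ ≤ h i`. -/
def circumscribed {n : ℕ} (v : Fin n → E) (h : Fin n → ℝ) : Set E :=
  {x | ∀ i, inner ℝ (v i) x ≤ h i}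

/-- The vectors `h` such that on each cone of `Δ` the values `h i` at the generators `v i` are
interpolated by a point of the polyhedron `circumscribed v h`. -/
def supportVectors {n : ℕ} (Δ : Set (Set E)) (v : Fin n → E) : Set (Fin n → ℝ) :=
  {h | ∀ I : Finset (Fin n), (PointedCone.hull ℝ (v '' I) : Set E) ∈ Δ →
    ∃ p ∈ circumscribed v h, ∀ i ∈ I, inner ℝ (v i) p = h i}

theorem supportFunction_mem_supportVectors [FiniteDimensional ℝ E] {n : ℕ} {Δ : Set (Set E)}
    (hΔ : IsSimplicialPolytopalFan Δ) (v : Fin n → E) {Q : Set E}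
    (hQ : Q ∈ deformationCone Δ) : (fun i => supportFunction Q (v i)) ∈ supportVectors Δ v := by
  obtain ⟨⟨P, hP, -, rfl⟩, -⟩ := hΔ
  intro I hI
  obtain ⟨p, hp, hpI⟩ := hQ.2.exists_forall_inner_le hQ.1.exists_forall_inner_le hI
  exact ⟨p, fun i => hQ.1.inner_le_supportFunction _ hp,
    fun i hi => (supportFunction_eq_inner hp (hpI i hi)).symm⟩

theorem convex_supportVectors {n : ℕ} (Δ : Set (Set E)) (v : Fin n → E) :
    Convex ℝ (supportVectors Δ v) := by
  intro h hh h' hh' s t hs ht hst I hI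
  obtain ⟨p, hp, hpI⟩ := hh I hI
  obtain ⟨p', hp', hpI'⟩ := hh' I hI
  refine ⟨s • p + t • p', fun i => ?_, fun i hi => ?_⟩
  · simp only [inner_add_right, inner_smul_right, Pi.add_apply, Pi.smul_apply, smul_eq_mul]
    exact add_le_add (mul_le_mul_of_nonneg_left (hp i) hs) (mul_le_mul_of_nonneg_left (hp' i) ht)
  · simp only [inner_add_right, inner_smul_right, Pi.add_apply, Pi.smul_apply, smul_eq_mul,
      hpI i hi, hpI' i hi]

/-- An injective linear map from a finite-dimensional space is bounded below; summing the constants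
over the finitely many `I` makes `K` uniform. -/
theorem exists_sum_abs_le_mul_norm {n : ℕ} (v : Fin n → E) :
    ∃ K : ℝ, 0 ≤ K ∧ ∀ I : Finset (Fin n), LinearIndepOn ℝ v (I : Set (Fin n)) →
      ∀ c : Fin n → ℝ, ∑ i ∈ I, |c i| ≤ K * ‖∑ i ∈ I, c i • v i‖ := by
  have h : ∀ I : Finset (Fin n), ∃ K : ℝ, 0 ≤ K ∧ (LinearIndepOn ℝ v (I : Set (Fin n)) →
      ∀ c : Fin n → ℝ, ∑ i ∈ I, |c i| ≤ K * ‖∑ i ∈ I, c i • v i‖) := by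
    intro I
    by_cases hI : LinearIndepOn ℝ v (I : Set (Fin n))
    · let f := Fintype.linearCombination ℝ (fun i : I => v i)
      have hf : LinearMap.ker f = ⊥ :=
        LinearMap.ker_eq_bot'.2 fun c hc => funext (Fintype.linearIndependent_iff.1 hI c hc)
      obtain ⟨K, -, hK⟩ := f.exists_antilipschitzWith hf
      refine ⟨I.card * K, by positivity, fun _ c => ?_⟩
      have h1 : ‖fun i : I => c i‖ ≤ K * ‖∑ i ∈ I, c i • v i‖ := by
        have := hK.le_mul_norm (map_zero f) (fun i : I => c i)
        rwa [Fintype.linearCombination_apply, Finset.sum_coe_sort I (fun i => c i • v i)] at this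
      calc ∑ i ∈ I, |c i| ≤ I.card • (K * ‖∑ i ∈ I, c i • v i‖) :=
            Finset.sum_le_card_nsmul _ _ _ fun i hi =>
              (norm_le_pi_norm (fun i : I => c i) ⟨i, hi⟩).trans h1
        _ = _ := by rw [nsmul_eq_mul, mul_assoc]
    · exact ⟨0, le_rfl, fun h => absurd h hI⟩
  choose K hK0 hK using h
  refine ⟨∑ I, K I, Finset.sum_nonneg fun I _ => hK0 I, fun I hI c => (hK I hI c).trans ?_⟩
  exact mul_le_mul_of_nonneg_right
    (Finset.single_le_sum (fun J _ => hK0 J) (Finset.mem_univ I)) (norm_nonneg _)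

/-- Expand `x` itself in the generators of a cone containing it and pair with `x`: ‖x‖² ≤ (∑ c i)‖h‖
≤ K‖x‖‖h‖. -/
theorem isBounded_circumscribed [FiniteDimensional ℝ E] {n : ℕ} {Δ : Set (Set E)}
    {v : Fin n → E} (hΔ : IsSimplicialPolytopalFan Δ) (hv : IsRayGenerators Δ v)
    (hne : (deformationCone Δ).Nonempty) (h : Fin n → ℝ) :
    Bornology.IsBounded (circumscribed v h) := by
  obtain ⟨Q, hQ⟩ := hne
  obtain ⟨K, hK0, hK⟩ := exists_sum_abs_le_mul_norm v
  refine (Metric.isBounded_iff_subset_closedBall (0 : E)).2 ⟨K * ‖h‖, fun x hx => ?_⟩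
  rw [mem_closedBall_zero_iff]
  obtain ⟨I, hI, -, c, hc, hcx⟩ := hv.exists_pos_combination hΔ hQ x
  rcases (norm_nonneg x).eq_or_lt with h0 | hpos
  · rw [← h0]; positivity
  refine le_of_mul_le_mul_right ?_ hpos
  calc ‖x‖ * ‖x‖ = inner ℝ x x := (real_inner_self_eq_norm_mul_norm x).symm
    _ = ∑ i ∈ I, c i * inner ℝ (v i) x := by
        conv_lhs => enter [2]; rw [hcx]
        simp [sum_inner, inner_smul_left]
    _ ≤ ∑ i ∈ I, |c i| * ‖h‖ := by
        refine Finset.sum_le_sum fun i hi => ?_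
        rw [abs_of_pos (hc i hi)]
        exact mul_le_mul_of_nonneg_left
          ((hx i).trans ((le_abs_self _).trans (norm_le_pi_norm h i))) (hc i hi).le
    _ = (∑ i ∈ I, |c i|) * ‖h‖ := by rw [Finset.sum_mul]
    _ ≤ K * ‖x‖ * ‖h‖ := by
        refine mul_le_mul_of_nonneg_right ?_ (norm_nonneg h)
        conv_rhs => rw [hcx]
        exact hK I hI c
    _ = K * ‖h‖ * ‖x‖ := by ring

theorem isPolyhedron_circumscribed {n : ℕ} (v : Fin n → E) (h : Fin n → ℝ) :
    IsPolyhedron (circumscribed v h) := ⟨n, v, h, rfl⟩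

/-- A convergent sequence of vectors has a common upper bound `B`, so the interpolating points lie
in the compact set `circumscribed v B` and subconverge. -/
theorem isClosed_supportVectors [FiniteDimensional ℝ E] {n : ℕ} {Δ : Set (Set E)}
    {v : Fin n → E} (hΔ : IsSimplicialPolytopalFan Δ) (hv : IsRayGenerators Δ v)
    (hne : (deformationCone Δ).Nonempty) : IsClosed (supportVectors Δ v) := by
  have := FiniteDimensional.proper ℝ E
  refine IsSeqClosed.isClosed fun h h₀ hh hlim I hI => ?_
  choose p hp hpI using fun k => hh k I hI
  obtain ⟨B, hB⟩ : BddAbove (Set.range h) := by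
    rw [bddAbove_pi]
    intro i
    have := ((tendsto_pi_nhds.1 hlim) i).bddAbove_range
    rwa [← Set.range_comp]
  have hcpt : IsCompact (circumscribed v B) := Metric.isCompact_of_isClosed_isBounded
    (isPolyhedron_circumscribed v B).isClosed (isBounded_circumscribed hΔ hv hne B)
  obtain ⟨p₀, -, φ, hφ, hφp⟩ := hcpt.tendsto_subseq (x := p) fun k i =>
    (hp k i).trans (hB ⟨k, rfl⟩ i)
  have hlim' : ∀ i, Tendsto (fun k => h (φ k) i) atTop (𝓝 (h₀ i)) := fun i =>
    ((tendsto_pi_nhds.1 hlim) i).comp hφ.tendsto_atTop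
  have hplim : ∀ i, Tendsto (fun k => (inner ℝ (v i) (p (φ k)) : ℝ)) atTop
      (𝓝 (inner ℝ (v i) p₀)) := fun i => tendsto_const_nhds.inner hφp
  refine ⟨p₀, fun i => le_of_tendsto_of_tendsto' (hplim i) (hlim' i) fun k => hp _ i,
    fun i hi => tendsto_nhds_unique (hplim i) ?_⟩
  exact (hlim' i).congr fun k => (hpI _ i hi).symm

theorem circumscribed_mem_deformationCone [FiniteDimensional ℝ E] {n : ℕ} {Δ : Set (Set E)}
    {v : Fin n → E} (hΔ : IsSimplicialPolytopalFan Δ) (hv : IsRayGenerators Δ v)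
    (hne : (deformationCone Δ).Nonempty) {h : Fin n → ℝ} (hh : h ∈ supportVectors Δ v) :
    circumscribed v h ∈ deformationCone Δ := by
  obtain ⟨Q, hQ⟩ := id hne
  refine ⟨⟨isPolyhedron_circumscribed v h, ?_, isBounded_circumscribed hΔ hv hne h⟩, ?_⟩
  · obtain ⟨I, -, hI, -⟩ := hv.exists_pos_combination hΔ hQ 0
    obtain ⟨p, hp, -⟩ := hh I hI
    exact ⟨p, hp⟩
  · rintro _ ⟨F, ⟨f₀, hf₀⟩, hFexp, rfl⟩
    refine ⟨{σ ∈ Δ | σ ⊆ normalCone (circumscribed v h) F}, Set.sep_subset _ _,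
      Set.Subset.antisymm (fun u hu => ?_) (Set.sUnion_subset fun σ hσ => hσ.2)⟩
    obtain ⟨I, -, hI, c, hc, rfl⟩ := hv.exists_pos_combination hΔ hQ u
    obtain ⟨p, hp, hpI⟩ := hh I hI
    -- The interpolating point `p` attains every bound `h i` on this cone, so a maximizer of `u`
    -- must attain them as well. The whole cone is then normal at `F`.
    have hFe : ∀ f ∈ F, ∀ i ∈ I, inner ℝ (v i) f = h i := by
      intro f hf
      have h1 : ∀ i ∈ I, c i * inner ℝ (v i) f ≤ c i * h i := fun i hi =>
        mul_le_mul_of_nonneg_left (hFexp.subset hf i) (hc i hi).le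
      have h2 := hu f hf p hp
      simp only [sum_inner, inner_smul_left, conj_trivial] at h2
      rw [Finset.sum_congr rfl fun i hi => by rw [hpI i hi]] at h2
      intro i hi
      have := (Finset.sum_eq_sum_iff_of_le h1).1 (le_antisymm (Finset.sum_le_sum h1) h2) i hi
      exact mul_left_cancel₀ (hc i hi).ne' this
    -- The absolute value is needed because `c` is controlled only on `I`.
    refine ⟨_, ⟨hI, fun z hz => ?_⟩, (mem_hull_image_finset v I _).2
      ⟨fun i => |c i|, fun i => abs_nonneg _, Finset.sum_congr rfl fun i hi => by
        simp only [abs_of_pos (hc i hi)]⟩⟩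
    obtain ⟨e, he, rfl⟩ := (mem_hull_image_finset v I z).1 hz
    intro f hf y hy
    simp only [sum_inner, inner_smul_left, conj_trivial]
    refine Finset.sum_le_sum fun i hi => mul_le_mul_of_nonneg_left ?_ (he i)
    rw [hFe f hf i hi]
    exact hy i

theorem supportFunction_circumscribed {n : ℕ} {Δ : Set (Set E)}
    {v : Fin n → E} (hv : IsRayGenerators Δ v) {h : Fin n → ℝ} (hh : h ∈ supportVectors Δ v)
    (i : Fin n) : supportFunction (circumscribed v h) (v i) = h i := by
  obtain ⟨p, hp, hpi⟩ := hh {i} (by simpa using hv.hull_singleton_mem i)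
  rw [supportFunction_eq_inner hp fun y hy => ?_, hpi i (by simp)]
  rw [hpi i (by simp)]
  exact hy i

/-- If `x` satisfies the inequalities of a polytope `R` of the deformation cone up to `ρ`, then its
distance to `R` is at most a constant multiple of `ρ`. -/
theorem exists_forall_dist_le_mul [FiniteDimensional ℝ E] {n : ℕ} {Δ : Set (Set E)}
    {v : Fin n → E} (hΔ : IsSimplicialPolytopalFan Δ) (hv : IsRayGenerators Δ v) :
    ∃ K : ℝ, 0 ≤ K ∧ ∀ R ∈ deformationCone Δ, ∀ ρ : ℝ, 0 ≤ ρ → ∀ x : E,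
      (∀ i, inner ℝ (v i) x ≤ supportFunction R (v i) + ρ) → ∃ p ∈ R, dist x p ≤ K * ρ := by
  obtain ⟨K, hK0, hK⟩ := exists_sum_abs_le_mul_norm v
  refine ⟨K, hK0, fun R hR ρ hρ x hx => ?_⟩
  have hconv : Convex ℝ R := hR.1.1.convex
  obtain ⟨p, hp, hpmin⟩ := exists_norm_eq_iInf_of_complete_convex hR.1.2.1
    hR.1.isCompact.isComplete hconv x
  have hpin := (norm_eq_iInf_iff_real_inner_le_zero hconv hp).1 hpmin
  refine ⟨p, hp, ?_⟩
  rw [dist_eq_norm]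
  obtain ⟨I, hI, hIΔ, c, hc, hcx⟩ := hv.exists_pos_combination hΔ hR (x - p)
  -- A single `q ∈ R` maximizes all generators of the cone, so the left side is `⟨x - p, q⟩`; the
  -- nearest point `p` maximizes `x - p` over `R`.
  have hqR : ∑ i ∈ I, c i * supportFunction R (v i) ≤ inner ℝ (x - p) p := by
    obtain ⟨⟨P, hP, -, rfl⟩, -⟩ := hΔ
    obtain ⟨q, hq, hqI⟩ := hR.2.exists_forall_inner_le hR.1.exists_forall_inner_le hIΔ
    have h1 := hpin q hq
    rw [inner_sub_right, sub_nonpos] at h1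
    refine le_trans (le_of_eq ?_) h1
    rw [hcx, sum_inner]
    refine Finset.sum_congr rfl fun i hi => ?_
    rw [inner_smul_left, supportFunction_eq_inner hq (hqI i hi), conj_trivial]
  rcases (norm_nonneg (x - p)).eq_or_lt with h0 | hpos
  · rw [← h0]; positivity
  refine le_of_mul_le_mul_right ?_ hpos
  have hxs : (inner ℝ (x - p) x : ℝ) = ∑ i ∈ I, c i * inner ℝ (v i) x := by
    rw [hcx]
    simp [sum_inner, inner_smul_left]
  calc ‖x - p‖ * ‖x - p‖ = inner ℝ (x - p) x - inner ℝ (x - p) p := by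
        rw [← real_inner_self_eq_norm_mul_norm, ← inner_sub_right]
    _ ≤ ∑ i ∈ I, c i * inner ℝ (v i) x - ∑ i ∈ I, c i * supportFunction R (v i) :=
        hxs ▸ sub_le_sub_left hqR _
    _ = ∑ i ∈ I, c i * (inner ℝ (v i) x - supportFunction R (v i)) := by
        rw [← Finset.sum_sub_distrib]; simp only [mul_sub]
    _ ≤ ∑ i ∈ I, |c i| * ρ := by
        refine Finset.sum_le_sum fun i hi => ?_
        rw [abs_of_pos (hc i hi)]
        exact mul_le_mul_of_nonneg_left (by linarith [hx i]) (hc i hi).le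
    _ = (∑ i ∈ I, |c i|) * ρ := by rw [Finset.sum_mul]
    _ ≤ K * ‖x - p‖ * ρ := by
        refine mul_le_mul_of_nonneg_right ?_ hρ
        rw [hcx]
        exact hK I hI c
    _ = K * ρ * ‖x - p‖ := by ring

theorem circumscribed_supportFunction [FiniteDimensional ℝ E] {n : ℕ} {Δ : Set (Set E)}
    {v : Fin n → E} (hΔ : IsSimplicialPolytopalFan Δ) (hv : IsRayGenerators Δ v)
    {Q : Set E} (hQ : Q ∈ deformationCone Δ) :
    circumscribed v (fun i => supportFunction Q (v i)) = Q := by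
  refine Set.Subset.antisymm (fun x hx => ?_) fun x hx i => hQ.1.inner_le_supportFunction _ hx
  obtain ⟨K, -, hK⟩ := exists_forall_dist_le_mul hΔ hv
  obtain ⟨p, hp, hxp⟩ := hK Q hQ 0 le_rfl x fun i => (hx i).trans (add_zero _).ge
  rw [mul_zero] at hxp
  rwa [dist_le_zero.1 hxp]

theorem exists_hausdorffDist_le_mul [FiniteDimensional ℝ E] {n : ℕ} {Δ : Set (Set E)}
    {v : Fin n → E} (hΔ : IsSimplicialPolytopalFan Δ) (hv : IsRayGenerators Δ v) :
    ∃ K : ℝ, 0 ≤ K ∧ ∀ Q ∈ deformationCone Δ, ∀ R ∈ deformationCone Δ, ∀ ρ : ℝ, 0 ≤ ρ →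
      (∀ i, |supportFunction Q (v i) - supportFunction R (v i)| ≤ ρ) →
        Metric.hausdorffDist Q R ≤ K * ρ := by
  obtain ⟨K, hK0, hK⟩ := exists_forall_dist_le_mul hΔ hv
  refine ⟨K, hK0, fun Q hQ R hR ρ hρ h => ?_⟩
  refine Metric.hausdorffDist_le_of_mem_dist (by positivity) (fun x hx => ?_) fun x hx => ?_
  · refine hK R hR ρ hρ x fun i => ?_
    linarith [(abs_le.1 (h i)).2, hQ.1.inner_le_supportFunction (v i) hx]
  · refine hK Q hQ ρ hρ x fun i => ?_
    linarith [(abs_le.1 (h i)).1, hR.1.inner_le_supportFunction (v i) hx]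

theorem hull_singleton_smul {w : E} {t : ℝ} (ht : 0 < t) :
    PointedCone.hull ℝ {t • w} = PointedCone.hull ℝ {w} := by
  ext x
  simp only [mem_hull_singleton_iff]
  constructor
  · rintro ⟨c, hc, rfl⟩
    exact ⟨c * t, by positivity, mul_smul _ _ _⟩
  · rintro ⟨c, hc, rfl⟩
    exact ⟨c * t⁻¹, by positivity, by rw [smul_smul, inv_mul_cancel_right₀ ht.ne']⟩

theorem IsRayGenerators.normalize {n : ℕ} {Δ : Set (Set E)} {v : Fin n → E}
    (hv : IsRayGenerators Δ v) : IsRayGenerators Δ fun i => (1 / ‖v i‖) • v i := by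
  unfold IsRayGenerators
  have h : ∀ i, PointedCone.hull ℝ {(1 / ‖v i‖) • v i} = PointedCone.hull ℝ {v i} := fun i =>
    hull_singleton_smul (one_div_pos.2 (norm_pos_iff.2 (hv.ne_zero i)))
  simp only [h]
  exact hv

theorem IsRayGenerators.injective {n : ℕ} {Δ : Set (Set E)} {v : Fin n → E}
    (hv : IsRayGenerators Δ v) : Function.Injective v := fun i j h =>
  hv.injOn (Set.mem_univ i) (Set.mem_univ j) (by simp only [h])

end DeformationCone

/-! ### A strong law for sub-Gaussian errors -/

section StrongLaw

variable {Ω : Type*} [MeasurableSpace Ω] {μ : Measure Ω}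

theorem hasSubgaussianMGF_of_hasLaw_gaussianReal {X : Ω → ℝ} {s c : NNReal} (hsc : s ≤ c)
    (hX : HasLaw X (gaussianReal 0 s) μ) : HasSubgaussianMGF X c μ where
  integrable_exp_mul t := by
    have h := integrable_exp_mul_gaussianReal (μ := 0) (v := s) t
    rw [← hX.map_eq] at h
    exact h.comp_aemeasurable hX.aemeasurable
  mgf_le t := by
    rw [mgf_gaussianReal hX.map_eq]
    have : (s : ℝ) ≤ c := hsc
    gcongr
    rw [zero_mul, zero_add]
    gcongr

theorem HasSubgaussianMGF.mono {X : Ω → ℝ} {c c' : NNReal} (h : HasSubgaussianMGF X c μ)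
    (hc : c ≤ c') : HasSubgaussianMGF X c' μ where
  integrable_exp_mul := h.integrable_exp_mul
  mgf_le t := (h.mgf_le t).trans (by
    have : (c : ℝ) ≤ c' := hc
    gcongr)

/-- The Chernoff bound is geometric in `m`, hence summable, and Borel–Cantelli applies. -/
theorem ae_eventually_sum_lt_of_hasSubgaussianMGF [IsProbabilityMeasure μ]
    {X : ℕ → Ω → ℝ} (hX : iIndepFun X μ)
    {c : NNReal} (hc : 0 < c) (hsub : ∀ l, HasSubgaussianMGF (X l) c μ) {t : ℝ} (ht : 0 < t) :
    ∀ᵐ ω ∂μ, ∀ᶠ m : ℕ in atTop, ∑ l ∈ Finset.range m, X l ω < m * t := by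
  have hbound : ∀ m : ℕ, μ {ω | m * t ≤ ∑ l ∈ Finset.range m, X l ω} ≤
      ENNReal.ofReal (Real.exp (-(t ^ 2 / (2 * c))) ^ m) := by
    intro m
    rw [← ENNReal.ofReal_toReal (measure_ne_top μ _)]
    refine ENNReal.ofReal_le_ofReal ?_
    refine (HasSubgaussianMGF.measure_sum_range_ge_le_of_iIndepFun hX
      (fun l _ => hsub l) (by positivity)).trans (le_of_eq ?_)
    rw [← Real.exp_nat_mul]
    congr 1
    have : (c : ℝ) ≠ 0 := by exact_mod_cast hc.ne'
    rcases eq_or_ne (m : ℝ) 0 with h | h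
    · simp [h]
    · field_simp
  have hpos : 0 < t ^ 2 / (2 * (c : ℝ)) := by
    have : (0 : ℝ) < c := hc
    positivity
  have hsum : Summable fun m : ℕ => Real.exp (-(t ^ 2 / (2 * c))) ^ m := by
    refine summable_geometric_of_lt_one (Real.exp_pos _).le (by rw [← Real.exp_zero]; exact Real.exp_lt_exp.2 (neg_neg_iff_pos.2 hpos))
  have hne : ∑' m : ℕ, μ {ω | m * t ≤ ∑ l ∈ Finset.range m, X l ω} ≠ ⊤ :=
    ne_top_of_le_ne_top hsum.tsum_ofReal_ne_top (ENNReal.tsum_le_tsum hbound)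
  filter_upwards [ae_eventually_notMem hne] with ω hω
  exact hω.mono fun m hm => by simpa using hm

/-- Strong law of large numbers for independent, uniformly sub-Gaussian random variables. -/
theorem ae_tendsto_sum_div_of_hasSubgaussianMGF [IsProbabilityMeasure μ]
    {X : ℕ → Ω → ℝ} (hX : iIndepFun X μ)
    {c : NNReal} (hc : 0 < c) (hsub : ∀ l, HasSubgaussianMGF (X l) c μ) :
    ∀ᵐ ω ∂μ, Tendsto (fun m : ℕ => (∑ l ∈ Finset.range m, X l ω) / m) atTop (𝓝 0) := by
  have hneg : iIndepFun (fun l => -X l) μ := hX.comp (fun _ x => -x) fun _ => measurable_neg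
  have h1 := fun k : ℕ => ae_eventually_sum_lt_of_hasSubgaussianMGF hX hc hsub
    (Nat.one_div_pos_of_nat (α := ℝ) (n := k))
  have h2 := fun k : ℕ => ae_eventually_sum_lt_of_hasSubgaussianMGF hneg hc
    (fun l => (hsub l).neg) (Nat.one_div_pos_of_nat (α := ℝ) (n := k))
  filter_upwards [ae_all_iff.2 h1, ae_all_iff.2 h2] with ω hω1 hω2
  rw [Metric.tendsto_nhds]
  intro e he
  obtain ⟨k, hk⟩ := exists_nat_one_div_lt he
  filter_upwards [hω1 k, hω2 k, eventually_gt_atTop 0] with m hm1 hm2 hm0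
  have hm : (0 : ℝ) < m := by exact_mod_cast hm0
  simp only [Pi.neg_apply, Finset.sum_neg_distrib] at hm2
  rw [Real.dist_eq, sub_zero, abs_div, abs_of_pos hm, div_lt_iff₀ hm]
  refine (abs_lt.2 ⟨by linarith, hm1⟩).trans ?_
  rw [mul_comm]
  exact mul_lt_mul_of_pos_right hk hm

theorem ae_tendsto_sum_indicator_div_of_gaussianReal [IsProbabilityMeasure μ]
    {ε : ℕ → Ω → ℝ} (hindep : iIndepFun ε μ)
    {γ : NNReal} {s : ℕ → NNReal} (hs : ∀ l, s l ≤ γ)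
    (hlaw : ∀ l, HasLaw (ε l) (gaussianReal 0 (s l)) μ) (A : Set ℕ) :
    ∀ᵐ ω ∂μ, Tendsto (fun m : ℕ => (∑ l ∈ Finset.range m, A.indicator (fun l => ε l ω) l) / m)
      atTop (𝓝 0) := by
  classical
  let X : ℕ → Ω → ℝ := fun l ω => A.indicator (fun l => ε l ω) l
  have hXeq : X = fun l => (fun x : ℝ => if l ∈ A then x else 0) ∘ ε l := by
    ext l ω
    simp [X, Set.indicator_apply]
  have hX : iIndepFun X μ := by
    rw [hXeq]
    refine hindep.comp _ fun l => ?_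
    by_cases h : l ∈ A
    · simpa [h] using measurable_id'
    · simp [h]
  -- The `+ 1` keeps the parameter positive when `γ = 0`.
  refine ae_tendsto_sum_div_of_hasSubgaussianMGF hX (c := γ + 1) (by positivity) fun l => ?_
  by_cases h : l ∈ A
  · have : X l = ε l := by ext ω; simp [X, h]
    change HasSubgaussianMGF (X l) _ _
    rw [this]
    exact hasSubgaussianMGF_of_hasLaw_gaussianReal ((hs l).trans le_self_add) (hlaw l)
  · have : X l = fun _ => 0 := by ext ω; simp [X, h]
    change HasSubgaussianMGF (X l) _ _
    rw [this]
    exact HasSubgaussianMGF.mono HasSubgaussianMGF.fun_zero zero_le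

end StrongLaw

/-! ### Least squares on a closed convex set, and consistency -/

section LeastSquares

theorem existsUnique_isLeast_sum_sq {n : ℕ} {T : Set (Fin n → ℝ)} (hT : IsClosed T)
    (hconv : Convex ℝ T) (hne : T.Nonempty) (k : ℕ → Fin n) (y : ℕ → ℝ) {m : ℕ}
    (hk : ∀ i, ∃ l < m, k l = i) :
    ∃! h, h ∈ T ∧ ∀ h' ∈ T, ∑ l ∈ Finset.range m, (h (k l) - y l) ^ 2 ≤
      ∑ l ∈ Finset.range m, (h' (k l) - y l) ^ 2 := by
  obtain ⟨h₀, hh₀⟩ := hne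
  set f : (Fin n → ℝ) → ℝ := fun h => ∑ l ∈ Finset.range m, (h (k l) - y l) ^ 2 with hf
  have hcoer : ∀ᶠ h in cocompact (Fin n → ℝ) ⊓ 𝓟 T, f h₀ ≤ f h := by
    refine Eventually.filter_mono inf_le_left ?_
    -- If `f h < f h₀`, every residual is at most `√(f h₀)`; as each coordinate is observed, `‖h‖ ≤
    -- r`.
    set r : ℝ := ∑ l ∈ Finset.range m, |y l| + √(f h₀)
    have hr : 0 ≤ r := by positivity
    filter_upwards [(isCompact_closedBall (0 : Fin n → ℝ) r).compl_mem_cocompact] with h hh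
    by_contra! hlt
    refine hh ?_
    rw [mem_closedBall_zero_iff, pi_norm_le_iff_of_nonneg hr]
    intro i
    obtain ⟨l, hl, rfl⟩ := hk i
    have hl' := Finset.mem_range.2 hl
    have h1 : |h (k l) - y l| ≤ √(f h₀) := by
      rw [← Real.sqrt_sq_eq_abs]
      exact Real.sqrt_le_sqrt ((Finset.single_le_sum
        (f := fun l => (h (k l) - y l) ^ 2) (fun l _ => sq_nonneg _) hl').trans hlt.le)
    have h2 : |y l| ≤ ∑ l ∈ Finset.range m, |y l| :=
      Finset.single_le_sum (f := fun l => |y l|) (fun l _ => abs_nonneg _) hl'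
    have h3 := abs_add_le (h (k l) - y l) (y l)
    rw [sub_add_cancel] at h3
    rw [Real.norm_eq_abs]
    linarith
  obtain ⟨h, hhT, hmin⟩ := ContinuousOn.exists_isMinOn' (f := f) (by fun_prop) hT hh₀ hcoer
  refine ⟨h, ⟨hhT, fun h' hh' => hmin hh'⟩, fun g ⟨hgT, hg⟩ => ?_⟩
  have hmid : (1 / 2 : ℝ) • h + (1 / 2 : ℝ) • g ∈ T :=
    hconv hhT hgT (by norm_num) (by norm_num) (by norm_num)
  have h1 : f h ≤ f ((1 / 2 : ℝ) • h + (1 / 2 : ℝ) • g) := hmin hmid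
  have h2 : f g ≤ f h := hg h hhT
  -- Parallelogram identity: two minimizers agree at every observed coordinate, hence everywhere.
  have h3 : f ((1 / 2 : ℝ) • h + (1 / 2 : ℝ) • g) =
      (f h + f g) / 2 - (∑ l ∈ Finset.range m, (h (k l) - g (k l)) ^ 2) / 4 := by
    simp only [hf, ← Finset.sum_add_distrib, Finset.sum_div, ← Finset.sum_sub_distrib]
    refine Finset.sum_congr rfl fun l _ => ?_
    simp only [Pi.add_apply, Pi.smul_apply, smul_eq_mul]
    ring
  have h4 : ∑ l ∈ Finset.range m, (h (k l) - g (k l)) ^ 2 = 0 :=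
    le_antisymm (by linarith) (Finset.sum_nonneg fun _ _ => sq_nonneg _)
  ext i
  obtain ⟨l, hl, rfl⟩ := hk i
  have := (Finset.sum_eq_zero_iff_of_nonneg fun _ _ => sq_nonneg _).1 h4 l (Finset.mem_range.2 hl)
  linarith [pow_eq_zero_iff (two_ne_zero) |>.1 this]

theorem sum_sq_le_of_sum_sq_sub_le {n : ℕ} (k : ℕ → Fin n) {m : ℕ} (hm : 0 < m) {δ : ℝ}
    (hδ : 0 < δ)
    (hk : ∀ i, m * δ ≤ (((Finset.range m).filter fun l => k l = i).card : ℝ))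
    (g : Fin n → ℝ) (e : ℕ → ℝ)
    (h : ∑ l ∈ Finset.range m, (g (k l) - e l) ^ 2 ≤ ∑ l ∈ Finset.range m, e l ^ 2) :
    ∑ i, g i ^ 2 ≤ 4 / δ ^ 2 *
      ∑ i, ((∑ l ∈ Finset.range m, {l | k l = i}.indicator e l) / m) ^ 2 := by
  have hm' : (0 : ℝ) < m := by exact_mod_cast hm
  set S : Fin n → ℝ := fun i => ∑ l ∈ Finset.range m, {l | k l = i}.indicator e l with hS
  have h1 : ∑ l ∈ Finset.range m, g (k l) ^ 2 ≤ 2 * ∑ l ∈ Finset.range m, g (k l) * e l := by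
    have : ∑ l ∈ Finset.range m, (g (k l) - e l) ^ 2 = ∑ l ∈ Finset.range m, g (k l) ^ 2 -
        2 * ∑ l ∈ Finset.range m, g (k l) * e l + ∑ l ∈ Finset.range m, e l ^ 2 := by
      rw [Finset.mul_sum, ← Finset.sum_sub_distrib, ← Finset.sum_add_distrib]
      exact Finset.sum_congr rfl fun l _ => by ring
    linarith
  have h2 : ∑ l ∈ Finset.range m, g (k l) * e l = ∑ i, g i * S i := by
    rw [← Finset.sum_fiberwise _ k]
    refine Finset.sum_congr rfl fun i _ => ?_
    simp only [hS, Finset.mul_sum, Set.indicator_apply, Set.mem_ofPred_eq, Finset.sum_filter,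
      mul_ite, mul_zero]
    refine Finset.sum_congr rfl fun l _ => ?_
    split_ifs with hl
    · rw [hl]
    · rfl
  have h3 : m * δ * ∑ i, g i ^ 2 ≤ ∑ l ∈ Finset.range m, g (k l) ^ 2 := by
    rw [← Finset.sum_fiberwise _ k, Finset.mul_sum]
    refine Finset.sum_le_sum fun i _ => ?_
    rw [Finset.sum_congr rfl fun l hl => by rw [(Finset.mem_filter.1 hl).2], Finset.sum_const,
      nsmul_eq_mul]
    exact mul_le_mul_of_nonneg_right (hk i) (sq_nonneg _)
  -- Young's inequality, weighted so that half of `δ * ∑ g i ^ 2` can be absorbed on the left.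
  have h4 : ∑ i, 2 * (g i * (S i / m)) ≤
      ∑ i, (δ / 2 * g i ^ 2 + 2 / δ * (S i / m) ^ 2) := by
    refine Finset.sum_le_sum fun i _ => ?_
    have : δ / 2 * g i ^ 2 + 2 / δ * (S i / m) ^ 2 - 2 * (g i * (S i / m)) =
        (δ * g i - 2 * (S i / m)) ^ 2 / (2 * δ) := by
      field_simp
      ring
    have h5 : 0 ≤ (δ * g i - 2 * (S i / m)) ^ 2 / (2 * δ) := by positivity
    linarith
  have h5 : δ * ∑ i, g i ^ 2 ≤ ∑ i, 2 * (g i * (S i / m)) := by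
    have h6 : ∑ i, 2 * (g i * (S i / m)) = (2 * ∑ i, g i * S i) / m := by
      rw [← Finset.mul_sum, mul_div_assoc, Finset.sum_div]
      simp only [mul_div_assoc]
    rw [h6, le_div_iff₀ hm']
    linarith [h2 ▸ h1]
  simp only [Finset.sum_add_distrib, ← Finset.mul_sum] at h4 h5
  have h6 : ∑ i, g i ^ 2 ≤ 2 / δ * (2 / δ * ∑ i, (S i / m) ^ 2) := by
    rw [div_mul_eq_mul_div, le_div_iff₀ hδ]
    linarith
  refine h6.trans (le_of_eq ?_)
  field_simp
  ring

variable {E : Type*} [NormedAddCommGroup E] [InnerProductSpace ℝ E] [FiniteDimensional ℝ E]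

/-- Transfers the minimization from polytopes to vectors, where convexity is available. -/
theorem mem_leastSquaresEstimates_iff {n : ℕ} {Δ : Set (Set E)}
    {v : Fin n → E} (hΔ : IsSimplicialPolytopalFan Δ) (hv : IsRayGenerators Δ v)
    (k : ℕ → Fin n) (y : ℕ → ℝ) {m : ℕ} (hm : 0 < m) (Q : Set E) :
    Q ∈ leastSquaresEstimates Δ (fun l => v (k l)) y m ↔ Q ∈ deformationCone Δ ∧
      ∀ h ∈ supportVectors Δ v, ∑ l ∈ Finset.range m, (supportFunction Q (v (k l)) - y l) ^ 2 ≤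
        ∑ l ∈ Finset.range m, (h (k l) - y l) ^ 2 := by
  have hm' : (0 : ℝ) < 1 / m := by positivity
  refine and_congr_right fun hQ => ⟨fun H h hh => ?_, fun H R hR => ?_⟩
  · have := le_of_mul_le_mul_left
      (H _ (circumscribed_mem_deformationCone hΔ hv ⟨Q, hQ⟩ hh)) hm'
    simpa only [supportFunction_circumscribed hv hh] using this
  · exact mul_le_mul_of_nonneg_left
      (H _ (supportFunction_mem_supportVectors hΔ v hR)) hm'.le

theorem existsUnique_mem_leastSquaresEstimates {n : ℕ} {Δ : Set (Set E)}
    {v : Fin n → E} (hΔ : IsSimplicialPolytopalFan Δ) (hv : IsRayGenerators Δ v)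
    (hne : (deformationCone Δ).Nonempty) (k : ℕ → Fin n) (y : ℕ → ℝ) {m : ℕ} (hm : 0 < m)
    (hk : ∀ i, ∃ l < m, k l = i) :
    ∃! Q, Q ∈ leastSquaresEstimates Δ (fun l => v (k l)) y m := by
  have hneT : (supportVectors Δ v).Nonempty :=
    hne.elim fun Q hQ => ⟨_, supportFunction_mem_supportVectors hΔ v hQ⟩
  obtain ⟨h, ⟨hhT, hmin⟩, huniq⟩ := existsUnique_isLeast_sum_sq
    (isClosed_supportVectors hΔ hv hne) (convex_supportVectors Δ v) hneT k y hk
  refine ⟨circumscribed v h, ?_, fun Q hQ => ?_⟩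
  · refine (mem_leastSquaresEstimates_iff hΔ hv k y hm _).2
      ⟨circumscribed_mem_deformationCone hΔ hv hne hhT, ?_⟩
    simpa only [supportFunction_circumscribed hv hhT] using hmin
  · obtain ⟨hQΔ, hQmin⟩ := (mem_leastSquaresEstimates_iff hΔ hv k y hm Q).1 hQ
    rw [← circumscribed_supportFunction hΔ hv hQΔ]
    exact congrArg _ (huniq _ ⟨supportFunction_mem_supportVectors hΔ v hQΔ, hQmin⟩)

theorem tendsto_hausdorffDist_leastSquaresEstimates {n : ℕ} {Δ : Set (Set E)}
    {v : Fin n → E} (hΔ : IsSimplicialPolytopalFan Δ) (hv : IsRayGenerators Δ v)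
    {P : Set E} (hP : P ∈ deformationCone Δ) (k : ℕ → Fin n) {δ : ℝ} (hδ : 0 < δ)
    (hk : ∀ᶠ m : ℕ in atTop, ∀ i,
      m * δ ≤ (((Finset.range m).filter fun l => k l = i).card : ℝ))
    {e : ℕ → ℝ} (he : ∀ i, Tendsto
      (fun m : ℕ => (∑ l ∈ Finset.range m, {l | k l = i}.indicator e l) / m) atTop (𝓝 0))
    {Q : ℕ → Set E} (hQ : ∀ᶠ m in atTop, Q m ∈ leastSquaresEstimates Δ (fun l => v (k l))
      (fun l => supportFunction P (v (k l)) + e l) m) :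
    Tendsto (fun m => Metric.hausdorffDist (Q m) P) atTop (𝓝 0) := by
  obtain ⟨K, hK0, hK⟩ := exists_hausdorffDist_le_mul hΔ hv
  have hlim : Tendsto (fun m : ℕ => K * √(4 / δ ^ 2 *
      ∑ i, ((∑ l ∈ Finset.range m, {l | k l = i}.indicator e l) / m) ^ 2)) atTop (𝓝 0) := by
    have h1 : Tendsto (fun m : ℕ => ∑ i,
        ((∑ l ∈ Finset.range m, {l | k l = i}.indicator e l) / m) ^ 2) atTop (𝓝 0) := by
      simpa using tendsto_finsetSum Finset.univ fun i _ => (he i).pow 2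
    simpa using ((h1.const_mul (4 / δ ^ 2)).sqrt).const_mul K
  refine squeeze_zero' (Eventually.of_forall fun m => Metric.hausdorffDist_nonneg) ?_ hlim
  filter_upwards [hk, hQ, eventually_gt_atTop 0] with m hkm hQm hm
  obtain ⟨hQΔ, hmin⟩ := (mem_leastSquaresEstimates_iff hΔ hv k _ hm _).1 hQm
  refine hK _ hQΔ P hP _ (Real.sqrt_nonneg _) fun i => ?_
  have hle := sum_sq_le_of_sum_sq_sub_le k hm hδ hkm
    (fun i => supportFunction (Q m) (v i) - supportFunction P (v i)) e (by
      have := hmin _ (supportFunction_mem_supportVectors hΔ v hP)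
      simpa [sub_sub] using this)
  rw [← Real.sqrt_sq_eq_abs]
  exact Real.sqrt_le_sqrt ((Finset.single_le_sum
    (f := fun i => (supportFunction (Q m) (v i) - supportFunction P (v i)) ^ 2)
    (fun _ _ => sq_nonneg _) (Finset.mem_univ i)).trans hle)

end LeastSquares

theorem corollary4p3 {d n : ℕ}
    (Δ : Set (Set (EuclideanSpace ℝ (Fin d)))) (hΔ : IsSimplicialPolytopalFan Δ)
    (v : Fin n → EuclideanSpace ℝ (Fin d)) (hv : IsRayGenerators Δ v)
    (u : ℕ → EuclideanSpace ℝ (Fin d)) (hu : ∀ l, ∃ i, u l = (1 / ‖v i‖) • v i)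
    (δ : ℝ) (hδ : 0 < δ) (N : ℕ)
    (hfreq : ∀ m : ℕ, N ≤ m → ∀ i : Fin n,
      (m : ℝ) * δ ≤ ({l : ℕ | l < m ∧ u l = (1 / ‖v i‖) • v i}.ncard : ℝ))
    (P : Set (EuclideanSpace ℝ (Fin d))) (hP : P ∈ deformationCone Δ)
    {Ω : Type*} [MeasurableSpace Ω] (μ : Measure Ω) [IsProbabilityMeasure μ]
    (ε : ℕ → Ω → ℝ) (hindep : iIndepFun ε μ)
    (γ : NNReal) (s : ℕ → NNReal) (hs : ∀ l, s l ≤ γ)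
    (hlaw : ∀ l, HasLaw (ε l) (gaussianReal 0 (s l)) μ) :
    (∀ m : ℕ, N ≤ m → 1 ≤ m → ∀ y : ℕ → ℝ, ∃! Q, Q ∈ leastSquaresEstimates Δ u y m) ∧
      ∀ᵐ ω ∂μ, ∀ Q : ℕ → Set (EuclideanSpace ℝ (Fin d)),
        (∀ᶠ m in atTop, Q m ∈ leastSquaresEstimates Δ u
          (fun l => supportFunction P (u l) + ε l ω) m) →
        Tendsto (fun m => Metric.hausdorffDist (Q m) P) atTop (𝓝 0) := by
  classical
  choose k hk using hu
  -- With unit generators the observed directions are themselves ray generators; their injectivity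
  -- turns the frequency hypothesis into a count of the indices `k l`.
  have hw := hv.normalize
  obtain rfl : u = fun l => (1 / ‖v (k l)‖) • v (k l) := funext hk
  have hcount : ∀ m : ℕ, N ≤ m → ∀ i,
      m * δ ≤ (((Finset.range m).filter fun l => k l = i).card : ℝ) := by
    intro m hm i
    refine (hfreq m hm i).trans (le_of_eq ?_)
    rw [← Set.ncard_coe_finset]
    congr 2
    ext l
    simp only [Set.mem_ofPred_eq, Finset.coe_filter, Finset.mem_range]
    exact and_congr_right fun _ => ⟨fun h => hw.injective h, fun h => by rw [h]⟩
  constructor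
  · intro m hNm hm y
    refine existsUnique_mem_leastSquaresEstimates hΔ hw ⟨P, hP⟩ k y hm fun i => ?_
    have h1 : (0 : ℝ) < m * δ := by
      have : (0 : ℝ) < m := by exact_mod_cast hm
      positivity
    have h2 : 0 < ((Finset.range m).filter fun l => k l = i).card := by
      exact_mod_cast h1.trans_le (hcount m hNm i)
    obtain ⟨l, hl⟩ := Finset.card_pos.1 h2
    rw [Finset.mem_filter, Finset.mem_range] at hl
    exact ⟨l, hl⟩
  -- The exceptional null set depends only on the finitely many per-direction averages, not on the
  -- choice of estimates.
  · filter_upwards [ae_all_iff.2 fun i =>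
      ae_tendsto_sum_indicator_div_of_gaussianReal hindep hs hlaw {l | k l = i}] with ω hω Q hQ
    exact tendsto_hausdorffDist_leastSquaresEstimates hΔ hw hP k hδ
      ((eventually_ge_atTop N).mono hcount) hω hQ
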